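/- **Proposition (base forms are horizontal coinvariant forms; connected case).** Let $k$ be a field, $H$ a Hopf algebra over $k$, and $(\Gamma,\mathrm d)$ a bicovariant first order differential calculus on $H$: $\Gamma$ is an $H$-bimodule, $\mathrm d:H\to\Gamma$ is $k$-linear with $\mathrm d(ab)=(\mathrm da)b+a\,\mathrm db$, $\Gamma$ is spanned by the elements $a\,\mathrm db$, and $\Gamma$ carries a left and a right $H$-coaction which are compatible with the bimodule structure and for which $\mathrm d$ is colinear. Let $\Omega^\bullet(H)=\Gamma^\wedge$ be its maximal prolongation, i.e. the quotient of the tensor algebra $H\oplus\Gamma\oplus(\Gamma\otimes_H\Gamma)\oplus\cdots$ by the ideal generated by all $\sum_i \mathrm da_i\otimes_H\mathrm db_i$ with $\sum_i a_i\,\mathrm db_i=0$, with the unique differential extending $\mathrm d$; let $\pi_0:\Omega^\bullet(H)\to H$ be the projection onto degree zero. Let $A$ be a right $H$-comodule algebra with coaction $\Delta_A:A\to A\otimes H$, and put $B=A^{\mathrm{co}H}=\{a:\Delta_A(a)=a\otimes1\}$. Assume that $B\subseteq A$ is a quantum principal bundle, i.e. a faithfully flat Hopf–Galois extension: $A\otimes_BA\to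 A\otimes H$, $a\otimes_B a'\mapsto (a\otimes 1)\Delta_A(a')$, is bijective, and $A$ is faithfully flat as a left $B$-module. Let $\Omega^\bullet(A)$ be a complete differential calculus on $A$: a differential graded algebra $\bigoplus_{n\ge0}\Omega^n(A)$ with $\Omega^0(A)=A$ and $\Omega^n(A)$ spanned by the elements $a^0\,\mathrm da^1\cdots\mathrm da^n$, such that $\Delta_A$ extends to a (necessarily unique) morphism of differential graded algebras $\Delta_A^\wedge:\Omega^\bullet(A)\to\Omega^\bullet(A)\otimes\Omega^\bullet(H)$, where the target is the graded tensor product, with $(\alpha\otimes\beta)(\alpha'\otimes\beta')=(-1)^{|\beta||\alpha'|}\alpha\alpha'\otimes\beta\beta'$ and $\mathrm d(\alpha\otimes\beta)=\mathrm d\alpha\otimes\beta+(-1)^{|\alpha|}\alpha\otimes\mathrm d\beta$. Define - the horizontal forms $\mathfrak{hor}^\bullet(A)=(\Delta_A^\wedge)^{-1}(\Omega^\bullet(A)\otimes H)$; - the base space forms $\Omega^\bullet(B)=\{\omega\in\Omega^\bullet(A):\Delta_A^\wedge(\omega)=\omega\otimes1\}$; - the right coaction on forms $\Delta_{\Omega^\bullet(A)}=(\mathrm{id}\otimes\pi_0)\circ\Delta_A^\wedge:\Omega^\bullet(A)\to\Omega^\bullet(A)\otimes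 H$, and the right coinvariant forms $\Omega^\bullet(A)^{\mathrm{co}H}=\{\omega:\Delta_{\Omega^\bullet(A)}(\omega)=\omega\otimes1\}$. Then: 1. $\Omega^\bullet(B)=\mathfrak{hor}^\bullet(A)\cap\Omega^\bullet(A)^{\mathrm{co}H}$. 2. If the calculus $(\Gamma,\mathrm d)$ on $H$ is connected, i.e. $\ker(\mathrm d:H\to\Gamma)=k\cdot 1$, then $$\Omega^\bullet(B)=\mathfrak{hor}^\bullet(A)\cap\mathrm d^{-1}\bigl(\mathfrak{hor}^\bullet(A)\bigr).$$ -/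

import Mathlib

set_option linter.unusedSectionVars false

open scoped TensorProduct DirectSum
open MulOpposite (op)

noncomputable section

namespace QuantumBundle

universe u v

/-! ### First order differential calculi -/

/-- A first order differential calculus `(Γ, d)` on a `k`-algebra `H`: an `H`-bimodule `Γ` (the
right action is written as an action of `Hᵐᵒᵖ`) and a linear map `d : H → Γ` that satisfies the
Leibniz rule, such that `Γ` is spanned by the elements `a d(b)`. -/
structure FirstOrderCalculus (k H Γ : Type*) [Field k] [Ring H] [Algebra k H]
    [AddCommGroup Γ] [Module k Γ] [Module H Γ] [Module Hᵐᵒᵖ Γ] [SMulCommClass H Hᵐᵒᵖ Γ]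
    [IsScalarTower k H Γ] [IsScalarTower k Hᵐᵒᵖ Γ] where
  d : H →ₗ[k] Γ
  leibniz : ∀ a b : H, d (a * b) = op b • d a + a • d b
  span_eq_top : Submodule.span k {ω : Γ | ∃ a b : H, ω = a • d b} = ⊤

section Bimodule

variable (k H Γ : Type*) [Field k] [Ring H] [Algebra k H]
  [AddCommGroup Γ] [Module k Γ] [Module H Γ] [Module Hᵐᵒᵖ Γ] [SMulCommClass H Hᵐᵒᵖ Γ]
  [IsScalarTower k H Γ] [IsScalarTower k Hᵐᵒᵖ Γ]

/-- The left action of `H` on `Γ` as a bilinear map `(h, γ) ↦ h γ`. -/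
def leftAct : H →ₗ[k] Γ →ₗ[k] Γ := (Algebra.lsmul k k Γ : H →ₐ[k] Module.End k Γ).toLinearMap

/-- The right action of `H` on `Γ` as a bilinear map `(h, γ) ↦ γ h`. -/
def rightAct : H →ₗ[k] Γ →ₗ[k] Γ :=
  (Algebra.lsmul k k Γ : Hᵐᵒᵖ →ₐ[k] Module.End k Γ).toLinearMap ∘ₗ
    (MulOpposite.opLinearEquiv k : H ≃ₗ[k] Hᵐᵒᵖ).toLinearMap

@[simp] theorem leftAct_apply (h : H) (γ : Γ) : leftAct k H Γ h γ = h • γ := rfl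

@[simp] theorem rightAct_apply (h : H) (γ : Γ) : rightAct k H Γ h γ = op h • γ := rfl

/-- Relations presenting the tensor algebra `H ⊕ Γ ⊕ (Γ ⊗_H Γ) ⊕ ⋯` of the `H`-bimodule `Γ` as a
quotient of the free `k`-algebra on the vector space `H ⊕ Γ`. -/
inductive TensorBundleRel : TensorAlgebra k (H × Γ) → TensorAlgebra k (H × Γ) → Prop
  | one : TensorBundleRel (TensorAlgebra.ι k (1, 0)) 1
  | mul (a b : H) : TensorBundleRel
      (TensorAlgebra.ι k (a, 0) * TensorAlgebra.ι k (b, 0)) (TensorAlgebra.ι k (a * b, 0))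
  | left (a : H) (γ : Γ) : TensorBundleRel
      (TensorAlgebra.ι k (a, 0) * TensorAlgebra.ι k (0, γ)) (TensorAlgebra.ι k (0, a • γ))
  | right (a : H) (γ : Γ) : TensorBundleRel
      (TensorAlgebra.ι k (0, γ) * TensorAlgebra.ι k (a, 0)) (TensorAlgebra.ι k (0, op a • γ))

/-- The tensor algebra `Γ^{⊗_H} = H ⊕ Γ ⊕ (Γ ⊗_H Γ) ⊕ ⋯` of the `H`-bimodule `Γ`. -/
def TensorBundle : Type _ := RingQuot (TensorBundleRel k H Γ)

instance : Ring (TensorBundle k H Γ) := inferInstanceAs (Ring (RingQuot (TensorBundleRel k H Γ)))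

instance : Algebra k (TensorBundle k H Γ) :=
  inferInstanceAs (Algebra k (RingQuot (TensorBundleRel k H Γ)))

namespace TensorBundle

/-- The quotient map from the free algebra. -/
def mk : TensorAlgebra k (H × Γ) →ₐ[k] TensorBundle k H Γ :=
  RingQuot.mkAlgHom k (TensorBundleRel k H Γ)

/-- The inclusion of `H` as the degree zero part. -/
def incl : H →ₐ[k] TensorBundle k H Γ :=
  AlgHom.ofLinearMap
    ((mk k H Γ).toLinearMap ∘ₗ TensorAlgebra.ι k ∘ₗ
      LinearMap.inl k H Γ)
    (by
      have h : mk k H Γ _ = mk k H Γ _ := RingQuot.mkAlgHom_rel k (TensorBundleRel.one (k := k) (H := H) (Γ := Γ))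
      simpa using h)
    (fun a b => by
      have h : mk k H Γ _ = mk k H Γ _ := RingQuot.mkAlgHom_rel k (TensorBundleRel.mul (k := k) (H := H) (Γ := Γ) a b)
      simpa using h.symm)

/-- The inclusion of `Γ` as the degree one part. -/
def form : Γ →ₗ[k] TensorBundle k H Γ :=
  (mk k H Γ).toLinearMap ∘ₗ TensorAlgebra.ι k ∘ₗ
    LinearMap.inr k H Γ

variable {k H Γ}

theorem form_smul (a : H) (γ : Γ) : form k H Γ (a • γ) = incl k H Γ a * form k H Γ γ := by
  have h : mk k H Γ _ = mk k H Γ _ := RingQuot.mkAlgHom_rel k (TensorBundleRel.left (k := k) (H := H) (Γ := Γ) a γ)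
  simpa [form, incl] using h.symm

theorem form_op_smul (a : H) (γ : Γ) :
    form k H Γ (op a • γ) = form k H Γ γ * incl k H Γ a := by
  have h : mk k H Γ _ = mk k H Γ _ := RingQuot.mkAlgHom_rel k (TensorBundleRel.right (k := k) (H := H) (Γ := Γ) a γ)
  simpa [form, incl] using h.symm

/-- The universal property of the tensor algebra of a bimodule. -/
def lift {R : Type*} [Ring R] [Algebra k R] (f : H →ₐ[k] R) (g : Γ →ₗ[k] R)
    (hl : ∀ a γ, g (a • γ) = f a * g γ) (hr : ∀ a γ, g (op a • γ) = g γ * f a) :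
    TensorBundle k H Γ →ₐ[k] R :=
  RingQuot.liftAlgHom k ⟨TensorAlgebra.lift k (f.toLinearMap.coprod g), by
    rintro _ _ (_ | ⟨a, b⟩ | ⟨a, γ⟩ | ⟨a, γ⟩)
    · simp
    · simp
    · simp [hl]
    · simp [hr]⟩

theorem lift_mk {R : Type*} [Ring R] [Algebra k R] (f : H →ₐ[k] R) (g : Γ →ₗ[k] R)
    (hl : ∀ a γ, g (a • γ) = f a * g γ) (hr : ∀ a γ, g (op a • γ) = g γ * f a)
    (x : TensorAlgebra k (H × Γ)) :
    lift f g hl hr (mk k H Γ x) = TensorAlgebra.lift k (f.toLinearMap.coprod g) x :=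
  RingQuot.liftAlgHom_mkAlgHom_apply k _ _ x

@[simp] theorem lift_incl {R : Type*} [Ring R] [Algebra k R] (f : H →ₐ[k] R) (g : Γ →ₗ[k] R)
    (hl : ∀ a γ, g (a • γ) = f a * g γ) (hr : ∀ a γ, g (op a • γ) = g γ * f a) (a : H) :
    lift f g hl hr (incl k H Γ a) = f a := by
  simp [incl, lift_mk]

@[simp] theorem lift_form {R : Type*} [Ring R] [Algebra k R] (f : H →ₐ[k] R) (g : Γ →ₗ[k] R)
    (hl : ∀ a γ, g (a • γ) = f a * g γ) (hr : ∀ a γ, g (op a • γ) = g γ * f a) (γ : Γ) :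
    lift f g hl hr (form k H Γ γ) = g γ := by
  simp [form, lift_mk]

theorem adjoin_eq_top :
    Algebra.adjoin k (Set.range (incl k H Γ) ∪ Set.range (form k H Γ)) = ⊤ := by
  rw [eq_top_iff]
  rintro x -
  obtain ⟨y, rfl⟩ : ∃ y, mk k H Γ y = x :=
    RingQuot.mkAlgHom_surjective k (TensorBundleRel k H Γ) x
  induction y using TensorAlgebra.induction with
  | algebraMap r => rw [AlgHom.commutes]; exact Subalgebra.algebraMap_mem _ r
  | ι m =>
    obtain ⟨a, γ⟩ := m
    have : (a, γ) = LinearMap.inl k H Γ a + LinearMap.inr k H Γ γ := by simp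
    rw [this, map_add, map_add]
    exact add_mem (Algebra.subset_adjoin (Or.inl ⟨a, rfl⟩))
      (Algebra.subset_adjoin (Or.inr ⟨γ, rfl⟩))
  | mul a b ha hb => rw [map_mul]; exact mul_mem ha hb
  | add a b ha hb => rw [map_add]; exact add_mem ha hb

end TensorBundle

end Bimodule

/-! ### Differential graded algebras and differential calculi -/

/-- A differential `ℕ`-graded `k`-algebra structure on the `k`-algebra `Ω`. -/
structure DGAlgebra (k Ω : Type*) [Field k] [Ring Ω] [Algebra k Ω] where
  gr : ℕ → Submodule k Ω
  [graded : GradedAlgebra gr]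
  d : Ω →ₗ[k] Ω
  d_mem : ∀ (n : ℕ) (x : Ω), x ∈ gr n → d x ∈ gr (n + 1)
  d_d : ∀ x : Ω, d (d x) = 0
  leibniz : ∀ (n : ℕ) (x y : Ω), x ∈ gr n → d (x * y) = d x * y + (-1 : k) ^ n • (x * d y)

attribute [instance] DGAlgebra.graded

/-- A differential calculus on the `k`-algebra `A`: a differential graded algebra `Ω` whose degree
zero part is (identified by `incl` with) `A`, and whose degree `n` part is spanned by the elements
`a⁰ d(a¹) ⋯ d(aⁿ)`. -/
structure DifferentialCalculus (k A Ω : Type*) [Field k] [Ring A] [Algebra k A] [Ring Ω]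
    [Algebra k Ω] extends DGAlgebra k Ω where
  incl : A →ₐ[k] Ω
  incl_injective : Function.Injective incl
  range_incl : LinearMap.range incl.toLinearMap = gr 0
  gr_eq_span : ∀ n : ℕ, gr n = Submodule.span k
    {ω : Ω | ∃ (a₀ : A) (a : Fin n → A),
      ω = incl a₀ * (List.ofFn fun i => d (incl (a i))).prod}

namespace DGAlgebra

variable {k Ω Ω' : Type*} [Field k] [Ring Ω] [Algebra k Ω] [Ring Ω'] [Algebra k Ω']

/-- The degree involution `x ↦ (-1)^n x` for `x` of degree `n`. -/
def degreeInvolution (C : DGAlgebra k Ω) : Ω →ₗ[k] Ω :=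
  DirectSum.toModule k ℕ Ω (fun n => (-1 : k) ^ n • (C.gr n).subtype) ∘ₗ
    (DirectSum.decomposeLinearEquiv C.gr).toLinearMap

/-- The algebra underlying the tensor product of two differential graded algebras: the tensor
product over `k`, with `(a ⊗ b)(a' ⊗ b') = (-1)^{|b||a'|} aa' ⊗ bb'`. -/
abbrev Tensor (C : DGAlgebra k Ω) (D : DGAlgebra k Ω') : Type _ :=
  GradedTensorProduct k C.gr D.gr

/-- The total degree `n` part of the tensor product, the sum of all `Ω^i ⊗ Ω'^j` with
`i + j = n`. -/
def tensorGr (C : DGAlgebra k Ω) (D : DGAlgebra k Ω') (n : ℕ) : Submodule k (C.Tensor D) :=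
  ⨆ p : {p : ℕ × ℕ // p.1 + p.2 = n},
    (LinearMap.range (TensorProduct.map (C.gr p.1.1).subtype (D.gr p.1.2).subtype)).map
      (GradedTensorProduct.of k C.gr D.gr).toLinearMap

/-- The differential `d(a ⊗ b) = da ⊗ b + (-1)^{|a|} a ⊗ db` of the tensor product. -/
def tensorD (C : DGAlgebra k Ω) (D : DGAlgebra k Ω') : C.Tensor D →ₗ[k] C.Tensor D :=
  (GradedTensorProduct.of k C.gr D.gr).toLinearMap ∘ₗ
    (TensorProduct.map C.d LinearMap.id + TensorProduct.map C.degreeInvolution D.d) ∘ₗ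
    (GradedTensorProduct.of k C.gr D.gr).symm.toLinearMap

/-- An algebra map `Φ : Ω → Ω ⊗ Ω'` is a morphism of differential graded algebras if it preserves
degrees and commutes with the differentials. -/
structure IsTensorMorphism (C : DGAlgebra k Ω) (D : DGAlgebra k Ω') (Φ : Ω →ₐ[k] C.Tensor D) :
    Prop where
  map_gr : ∀ (n : ℕ) (x : Ω), x ∈ C.gr n → Φ x ∈ C.tensorGr D n
  map_d : ∀ x : Ω, Φ (C.d x) = C.tensorD D (Φ x)

end DGAlgebra

/-- The projection `π₀ : Ω → A` of a differential calculus onto its degree zero part `Ω⁰ = A`. -/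
def DifferentialCalculus.projZero {k A Ω : Type*} [Field k] [Ring A] [Algebra k A] [Ring Ω]
    [Algebra k Ω] (C : DifferentialCalculus k A Ω) : Ω →ₗ[k] A :=
  ((LinearEquiv.ofInjective C.incl.toLinearMap C.incl_injective).trans
      (LinearEquiv.ofEq _ _ C.range_incl)).symm.toLinearMap ∘ₗ
    DirectSum.component k ℕ (fun n => C.gr n) 0 ∘ₗ
    (DirectSum.decomposeLinearEquiv C.gr).toLinearMap

/-! ### The maximal prolongation -/

namespace FirstOrderCalculus

section Prolongation

variable {k H Γ : Type*} [Field k] [Ring H] [Algebra k H]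
  [AddCommGroup Γ] [Module k Γ] [Module H Γ] [Module Hᵐᵒᵖ Γ] [SMulCommClass H Hᵐᵒᵖ Γ]
  [IsScalarTower k H Γ] [IsScalarTower k Hᵐᵒᵖ Γ]

/-- The calculus is connected if the kernel of `d` consists of the scalars only. -/
def IsConnected (F : FirstOrderCalculus k H Γ) : Prop :=
  ∀ h : H, F.d h = 0 ↔ ∃ c : k, h = algebraMap k H c

/-- The linear map `∑ aᵢ ⊗ bᵢ ↦ ∑ aᵢ d(bᵢ)`. -/
def adb (F : FirstOrderCalculus k H Γ) : H ⊗[k] H →ₗ[k] Γ :=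
  TensorProduct.lift ((leftAct k H Γ).compl₂ F.d)

/-- The linear map `∑ aᵢ ⊗ bᵢ ↦ ∑ d(aᵢ) d(bᵢ)` into a `k`-algebra `R`, for a given map
`g : Γ → R`. -/
def dadb (F : FirstOrderCalculus k H Γ) {R : Type*} [Ring R] [Algebra k R] (g : Γ →ₗ[k] R) :
    H ⊗[k] H →ₗ[k] R :=
  TensorProduct.lift ((LinearMap.mul k R).compl₁₂ (g ∘ₗ F.d) (g ∘ₗ F.d))

@[simp] theorem adb_tmul (F : FirstOrderCalculus k H Γ) (a b : H) :
    F.adb (a ⊗ₜ b) = a • F.d b := rfl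

@[simp] theorem dadb_tmul (F : FirstOrderCalculus k H Γ) {R : Type*} [Ring R] [Algebra k R]
    (g : Γ →ₗ[k] R) (a b : H) : F.dadb g (a ⊗ₜ b) = g (F.d a) * g (F.d b) := rfl

/-- The relations `∑ d(aᵢ) ⊗ d(bᵢ) = 0` whenever `∑ aᵢ d(bᵢ) = 0`, generating the ideal by which
the tensor algebra of `Γ` is divided. -/
inductive ProlongationRel (F : FirstOrderCalculus k H Γ) :
    TensorBundle k H Γ → TensorBundle k H Γ → Prop
  | mk (t : H ⊗[k] H) (ht : F.adb t = 0) : F.ProlongationRel (F.dadb (TensorBundle.form k H Γ) t) 0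

/-- The algebra underlying the maximal prolongation `Γ^∧` of `(Γ, d)`. -/
def Prolongation (F : FirstOrderCalculus k H Γ) : Type _ := RingQuot F.ProlongationRel

variable (F : FirstOrderCalculus k H Γ)

instance : Ring F.Prolongation := inferInstanceAs (Ring (RingQuot F.ProlongationRel))

instance : Algebra k F.Prolongation := inferInstanceAs (Algebra k (RingQuot F.ProlongationRel))

/-- The quotient map `Γ^{⊗_H} → Γ^∧`. -/
def mkP : TensorBundle k H Γ →ₐ[k] F.Prolongation := RingQuot.mkAlgHom k F.ProlongationRel

/-- `H` as the degree zero part of `Γ^∧`. -/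
def inclP : H →ₐ[k] F.Prolongation :=
  F.mkP.comp (TensorBundle.incl k H Γ)

/-- `Γ` as the degree one part of `Γ^∧`. -/
def formP : Γ →ₗ[k] F.Prolongation :=
  F.mkP.toLinearMap ∘ₗ TensorBundle.form k H Γ

theorem formP_smul (a : H) (γ : Γ) : F.formP (a • γ) = F.inclP a * F.formP γ := by
  simp [formP, inclP, TensorBundle.form_smul]

theorem formP_op_smul (a : H) (γ : Γ) : F.formP (op a • γ) = F.formP γ * F.inclP a := by
  simp [formP, inclP, TensorBundle.form_op_smul]

theorem map_dadb {R S : Type*} [Ring R] [Algebra k R] [Ring S] [Algebra k S] (φ : R →ₐ[k] S)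
    (g : Γ →ₗ[k] R) (t : H ⊗[k] H) : φ (F.dadb g t) = F.dadb (φ.toLinearMap ∘ₗ g) t := by
  have : φ.toLinearMap ∘ₗ F.dadb g = F.dadb (φ.toLinearMap ∘ₗ g) := by
    ext a b; simp
  exact LinearMap.congr_fun this t

theorem dadb_formP (t : H ⊗[k] H) (ht : F.adb t = 0) : F.dadb (R := F.Prolongation) F.formP t = 0 := by
  have h : F.mkP _ = F.mkP _ := RingQuot.mkAlgHom_rel k (ProlongationRel.mk (F := F) t ht)
  rw [map_dadb, map_zero] at h
  exact h

/-- The universal property of `Γ^∧`. -/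
def liftP {R : Type*} [Ring R] [Algebra k R] (f : H →ₐ[k] R) (g : Γ →ₗ[k] R)
    (hl : ∀ a γ, g (a • γ) = f a * g γ) (hr : ∀ a γ, g (op a • γ) = g γ * f a)
    (hd : ∀ t, F.adb t = 0 → F.dadb g t = 0) : F.Prolongation →ₐ[k] R :=
  RingQuot.liftAlgHom k ⟨TensorBundle.lift f g hl hr, by
    rintro _ _ ⟨t, ht⟩
    rw [map_dadb, map_zero, ← hd t ht]
    congr 2
    ext γ
    simp⟩

theorem liftP_mkP {R : Type*} [Ring R] [Algebra k R] (f : H →ₐ[k] R) (g : Γ →ₗ[k] R)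
    (hl : ∀ a γ, g (a • γ) = f a * g γ) (hr : ∀ a γ, g (op a • γ) = g γ * f a)
    (hd : ∀ t, F.adb t = 0 → F.dadb g t = 0) (x : TensorBundle k H Γ) :
    F.liftP f g hl hr hd (F.mkP x) = TensorBundle.lift f g hl hr x :=
  RingQuot.liftAlgHom_mkAlgHom_apply k _ _ x

section
variable {R : Type*} [Ring R] [Algebra k R] (f : H →ₐ[k] R) (g : Γ →ₗ[k] R)
    (hl : ∀ a γ, g (a • γ) = f a * g γ) (hr : ∀ a γ, g (op a • γ) = g γ * f a)
    (hd : ∀ t, F.adb t = 0 → F.dadb g t = 0)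

@[simp] theorem liftP_inclP (a : H) : F.liftP f g hl hr hd (F.inclP a) = f a := by
  simp [inclP, liftP_mkP]

@[simp] theorem liftP_formP (γ : Γ) : F.liftP f g hl hr hd (F.formP γ) = g γ := by
  simp [formP, liftP_mkP]
end

theorem adjoinP_eq_top :
    Algebra.adjoin k (Set.range F.inclP ∪ Set.range F.formP) = ⊤ := by
  have h := congrArg (Subalgebra.map F.mkP)
    (TensorBundle.adjoin_eq_top (k := k) (H := H) (Γ := Γ))
  rw [AlgHom.map_adjoin, Algebra.map_top,
    (AlgHom.range_eq_top F.mkP).2 (RingQuot.mkAlgHom_surjective k F.ProlongationRel), Set.image_union,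
    ← Set.range_comp, ← Set.range_comp] at h
  exact h

theorem inductionP {p : F.Prolongation → Prop} (hi : ∀ a, p (F.inclP a)) (hf : ∀ γ, p (F.formP γ))
    (hadd : ∀ x y, p x → p y → p (x + y)) (hmul : ∀ x y, p x → p y → p (x * y))
    (x : F.Prolongation) : p x := by
  have hx : x ∈ Algebra.adjoin k (Set.range F.inclP ∪ Set.range F.formP) := by
    rw [adjoinP_eq_top]; trivial
  induction hx using Algebra.adjoin_induction with
  | mem x hx =>
    rcases hx with ⟨a, rfl⟩ | ⟨γ, rfl⟩
    · exact hi a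
    · exact hf γ
  | algebraMap r => simpa using hi (algebraMap k H r)
  | add x y _ _ hx hy => exact hadd x y hx hy
  | mul x y _ _ hx hy => exact hmul x y hx hy

theorem adb_surjective : Function.Surjective F.adb := by
  rw [← LinearMap.range_eq_top, eq_top_iff, ← F.span_eq_top, Submodule.span_le]
  rintro _ ⟨a, b, rfl⟩
  exact ⟨a ⊗ₜ b, rfl⟩

theorem d_one : F.d 1 = 0 := by
  have h := F.leibniz 1 1
  simpa using h

/-- The map `Γ → Γ^∧`, `∑ aᵢ d(bᵢ) ↦ ∑ d(aᵢ) d(bᵢ)`. -/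
def deltaP : Γ →ₗ[k] F.Prolongation :=
  (LinearMap.ker F.adb).liftQ (F.dadb F.formP) (fun t ht => F.dadb_formP t ht) ∘ₗ
    (F.adb.quotKerEquivOfSurjective F.adb_surjective).symm.toLinearMap

theorem deltaP_adb (t : H ⊗[k] H) : F.deltaP (F.adb t) = F.dadb F.formP t := by
  have h : (F.adb.quotKerEquivOfSurjective F.adb_surjective).symm (F.adb t) =
      Submodule.Quotient.mk t := by
    rw [LinearEquiv.symm_apply_eq]; rfl
  rw [deltaP, LinearMap.comp_apply, LinearEquiv.coe_coe, h]
  rfl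

theorem deltaP_smul_d (a b : H) :
    F.deltaP (a • F.d b) = F.formP (F.d a) * F.formP (F.d b) := by
  simpa using F.deltaP_adb (a ⊗ₜ b)

theorem deltaP_d (a : H) : F.deltaP (F.d a) = 0 := by
  have h := F.deltaP_smul_d 1 a
  simpa [d_one] using h

theorem induction_form {p : Γ → Prop} (h : ∀ a b : H, p (a • F.d b)) (h0 : p 0)
    (hadd : ∀ x y, p x → p y → p (x + y)) (γ : Γ) : p γ := by
  obtain ⟨t, rfl⟩ := F.adb_surjective γ
  induction t using TensorProduct.induction_on with
  | zero => simpa using h0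
  | tmul a b => simpa using h a b
  | add x y hx hy => rw [map_add]; exact hadd _ _ hx hy

theorem deltaP_smul (a : H) (γ : Γ) :
    F.deltaP (a • γ) = F.formP (F.d a) * F.formP γ + F.inclP a * F.deltaP γ := by
  induction γ using F.induction_form with
  | h b c =>
    rw [smul_smul, deltaP_smul_d, deltaP_smul_d, F.leibniz, map_add, formP_op_smul, formP_smul,
      formP_smul]
    noncomm_ring
  | h0 => simp
  | hadd x y hx hy =>
    rw [smul_add, map_add, hx, hy, map_add, map_add]
    noncomm_ring

theorem deltaP_op_smul (a : H) (γ : Γ) :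
    F.deltaP (op a • γ) = F.deltaP γ * F.inclP a - F.formP γ * F.formP (F.d a) := by
  induction γ using F.induction_form with
  | h b c =>
    have h1 : op a • b • F.d c = b • F.d (c * a) - (b * c) • F.d a := by
      rw [F.leibniz, smul_add, smul_smul, add_sub_cancel_right]
      exact (smul_comm b (op a) (F.d c)).symm
    rw [h1, map_sub, deltaP_smul_d, deltaP_smul_d, deltaP_smul_d, F.leibniz, F.leibniz, map_add,
      map_add, formP_op_smul, formP_op_smul, formP_smul, formP_smul]
    noncomm_ring
  | h0 => simp
  | hadd x y hx hy =>
    rw [smul_add, map_add, hx, hy, map_add, map_add]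
    noncomm_ring

/-- The map `γ ↦ [[-γ, dγ], [0, γ]]`. -/
def matrixForm : Γ →ₗ[k] Matrix (Fin 2) (Fin 2) F.Prolongation where
  toFun γ := !![-F.formP γ, F.deltaP γ; 0, F.formP γ]
  map_add' a b := by ext i j; fin_cases i <;> fin_cases j <;> simp [add_comm]
  map_smul' c a := by ext i j; fin_cases i <;> fin_cases j <;> simp

/-- The map `a ↦ [[a, da], [0, a]]`. -/
def matrixIncl : H →ₐ[k] Matrix (Fin 2) (Fin 2) F.Prolongation :=
  AlgHom.ofLinearMap
    { toFun := fun a => !![F.inclP a, F.formP (F.d a); 0, F.inclP a]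
      map_add' := fun a b => by ext i j; fin_cases i <;> fin_cases j <;> simp
      map_smul' := fun c a => by ext i j; fin_cases i <;> fin_cases j <;> simp }
    (by ext i j; fin_cases i <;> fin_cases j <;> simp [d_one])
    (fun a b => by
      ext i j
      fin_cases i <;> fin_cases j <;>
        simp [F.leibniz, formP_smul, formP_op_smul, Matrix.mul_apply, Fin.sum_univ_two,
          add_comm])

theorem matrixForm_apply (γ : Γ) :
    F.matrixForm γ = !![-F.formP γ, F.deltaP γ; 0, F.formP γ] := rfl

theorem matrixIncl_apply (a : H) :
    F.matrixIncl a = !![F.inclP a, F.formP (F.d a); 0, F.inclP a] := rfl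

theorem dadb_matrixForm (s : H ⊗[k] H) :
    F.dadb F.matrixForm s =
      !![(F.dadb F.formP s : F.Prolongation), 0; 0, (F.dadb F.formP s : F.Prolongation)] := by
  induction s using TensorProduct.induction_on with
  | zero => ext i j; fin_cases i <;> fin_cases j <;> simp
  | tmul a b =>
    ext i j
    fin_cases i <;> fin_cases j <;>
      simp [matrixForm_apply, deltaP_d, Matrix.mul_apply, Fin.sum_univ_two]
  | add x y hx hy =>
    rw [map_add, hx, hy]
    ext i j
    fin_cases i <;> fin_cases j <;> simp

/-- The algebra map `x ↦ [[(-1)^{|x|} x, dx], [0, x]]` which encodes the graded derivation `d`. -/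
def matrixP : F.Prolongation →ₐ[k] Matrix (Fin 2) (Fin 2) F.Prolongation :=
  F.liftP F.matrixIncl F.matrixForm
    (fun a γ => by
      ext i j
      fin_cases i <;> fin_cases j <;>
        simp [matrixForm_apply, matrixIncl_apply, formP_smul, deltaP_smul, Matrix.mul_apply,
          Fin.sum_univ_two, add_comm])
    (fun a γ => by
      ext i j
      fin_cases i <;> fin_cases j <;>
        simp [matrixForm_apply, matrixIncl_apply, formP_op_smul, deltaP_op_smul,
          Matrix.mul_apply, Fin.sum_univ_two, sub_eq_add_neg, add_comm])
    (fun t ht => by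
      rw [dadb_matrixForm, F.dadb_formP t ht]
      ext i j
      fin_cases i <;> fin_cases j <;> simp)

theorem matrixP_inclP (a : H) :
    F.matrixP (F.inclP a) = !![F.inclP a, F.formP (F.d a); 0, F.inclP a] := by
  rw [matrixP, liftP_inclP, matrixIncl_apply]

theorem matrixP_formP (γ : Γ) :
    F.matrixP (F.formP γ) = !![-F.formP γ, F.deltaP γ; 0, F.formP γ] := by
  rw [matrixP, liftP_formP, matrixForm_apply]

theorem matrixP_lower (x : F.Prolongation) : F.matrixP x 1 0 = 0 ∧ F.matrixP x 1 1 = x := by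
  induction x using F.inductionP with
  | hi a => simp [matrixP_inclP]
  | hf γ => simp [matrixP_formP]
  | hadd x y hx hy => simp [hx, hy]
  | hmul x y hx hy => simp [hx, hy, Matrix.mul_apply, Fin.sum_univ_two]

/-- The sign automorphism of `Γ^∧`. -/
def signP (x : F.Prolongation) : F.Prolongation := F.matrixP x 0 0

/-- The differential of `Γ^∧`. -/
def dP : F.Prolongation →ₗ[k] F.Prolongation where
  toFun x := F.matrixP x 0 1
  map_add' x y := by simp
  map_smul' c x := by simp

theorem signP_mul (x y : F.Prolongation) : F.signP (x * y) = F.signP x * F.signP y := by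
  simp [signP, Matrix.mul_apply, Fin.sum_univ_two, matrixP_lower]

theorem dP_mul (x y : F.Prolongation) : F.dP (x * y) = F.dP x * y + F.signP x * F.dP y := by
  simp [dP, signP, Matrix.mul_apply, Fin.sum_univ_two, matrixP_lower, add_comm]

theorem dP_inclP (a : H) : F.dP (F.inclP a) = F.formP (F.d a) := by simp [dP, matrixP_inclP]

theorem dP_formP (γ : Γ) : F.dP (F.formP γ) = F.deltaP γ := by simp [dP, matrixP_formP]

theorem dP_deltaP (γ : Γ) : F.dP (F.deltaP γ) = 0 := by
  induction γ using F.induction_form with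
  | h a b => simp [deltaP_smul_d, dP_mul, dP_formP, deltaP_d]
  | h0 => simp
  | hadd x y hx hy => simp [hx, hy]

/-- The degree `n` part of `Γ^∧`, spanned by the products `h γ₁ ⋯ γₙ`. -/
def grP (n : ℕ) : Submodule k F.Prolongation :=
  LinearMap.range F.inclP.toLinearMap * LinearMap.range F.formP ^ n

theorem grP_zero : F.grP 0 = LinearMap.range F.inclP.toLinearMap := by simp [grP]

theorem grP_succ (n : ℕ) : F.grP (n + 1) = F.grP n * LinearMap.range F.formP := by
  rw [grP, grP, pow_succ, mul_assoc]

theorem incl_mul_incl : LinearMap.range F.inclP.toLinearMap * LinearMap.range F.inclP.toLinearMap ≤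
    LinearMap.range F.inclP.toLinearMap := by
  rw [Submodule.mul_le]
  rintro _ ⟨a, rfl⟩ _ ⟨b, rfl⟩
  exact ⟨a * b, by simp⟩

theorem one_le_incl : (1 : Submodule k F.Prolongation) ≤ LinearMap.range F.inclP.toLinearMap := by
  rw [Submodule.one_le]
  exact ⟨1, by simp⟩

theorem form_mul_incl : LinearMap.range F.formP * LinearMap.range F.inclP.toLinearMap ≤
    LinearMap.range F.formP := by
  rw [Submodule.mul_le]
  rintro _ ⟨γ, rfl⟩ _ ⟨b, rfl⟩
  exact ⟨op b • γ, by simp [formP_op_smul]⟩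

theorem incl_mul_form : LinearMap.range F.inclP.toLinearMap * LinearMap.range F.formP =
    LinearMap.range F.formP := by
  apply le_antisymm
  · rw [Submodule.mul_le]
    rintro _ ⟨b, rfl⟩ _ ⟨γ, rfl⟩
    exact ⟨b • γ, by simp [formP_smul]⟩
  · calc _ = 1 * LinearMap.range F.formP := (one_mul _).symm
      _ ≤ _ := mul_le_mul' F.one_le_incl le_rfl

theorem pow_mul_incl (n : ℕ) :
    LinearMap.range F.formP ^ n * LinearMap.range F.inclP.toLinearMap ≤ F.grP n := by
  cases n with
  | zero => simp [grP]
  | succ n =>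
    calc _ = LinearMap.range F.formP ^ n *
          (LinearMap.range F.formP * LinearMap.range F.inclP.toLinearMap) := by
            rw [pow_succ, mul_assoc]
      _ ≤ LinearMap.range F.formP ^ n * LinearMap.range F.formP :=
          mul_le_mul' le_rfl F.form_mul_incl
      _ = 1 * LinearMap.range F.formP ^ (n + 1) := by rw [pow_succ, one_mul]
      _ ≤ _ := mul_le_mul' F.one_le_incl le_rfl

theorem grP_mul (m n : ℕ) : F.grP m * F.grP n ≤ F.grP (m + n) := by
  calc F.grP m * F.grP n = LinearMap.range F.inclP.toLinearMap *
        (LinearMap.range F.formP ^ m * LinearMap.range F.inclP.toLinearMap) *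
        LinearMap.range F.formP ^ n := by simp only [grP, mul_assoc]
    _ ≤ LinearMap.range F.inclP.toLinearMap * F.grP m * LinearMap.range F.formP ^ n :=
        mul_le_mul' (mul_le_mul' le_rfl (F.pow_mul_incl m)) le_rfl
    _ = (LinearMap.range F.inclP.toLinearMap * LinearMap.range F.inclP.toLinearMap) *
        LinearMap.range F.formP ^ (m + n) := by simp only [grP, pow_add, mul_assoc]
    _ ≤ _ := mul_le_mul' F.incl_mul_incl le_rfl

theorem formP_mem (γ : Γ) : F.formP γ ∈ F.grP 1 := by
  rw [grP, pow_one, incl_mul_form]; exact ⟨γ, rfl⟩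

theorem inclP_mem (a : H) : F.inclP a ∈ F.grP 0 := by
  rw [grP_zero]; exact ⟨a, rfl⟩

instance gradedMonoidP : SetLike.GradedMonoid F.grP where
  one_mem := by simpa using F.inclP_mem 1
  mul_mem m n x y hx hy := F.grP_mul m n (Submodule.mul_mem_mul hx hy)

theorem grP_induction {p : (n : ℕ) → F.Prolongation → Prop} (h0 : ∀ a, p 0 (F.inclP a))
    (hadd : ∀ n x y, p n x → p n y → p n (x + y))
    (hmul : ∀ n x γ, x ∈ F.grP n → p n x → p (n + 1) (x * F.formP γ)) (n : ℕ)
    (x : F.Prolongation) (hx : x ∈ F.grP n) : p n x := by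
  induction n generalizing x with
  | zero =>
    rw [grP_zero] at hx
    obtain ⟨a, rfl⟩ := hx
    exact h0 a
  | succ n ih =>
    rw [grP_succ] at hx
    refine Submodule.mul_induction_on hx ?_ (hadd (n + 1))
    rintro y hy _ ⟨γ, rfl⟩
    exact hmul n y γ hy (ih y hy)

theorem ofP_mul {m n p : ℕ} {x y z : F.Prolongation} (hx : x ∈ F.grP m) (hy : y ∈ F.grP n)
    (hz : z ∈ F.grP p) (hp : m + n = p) (h : x * y = z) :
    DirectSum.of (fun n => F.grP n) m ⟨x, hx⟩ * DirectSum.of (fun n => F.grP n) n ⟨y, hy⟩ =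
      DirectSum.of (fun n => F.grP n) p ⟨z, hz⟩ := by
  subst hp h
  rw [DirectSum.of_mul_of]
  rfl

/-- A linear map `V → Γ^∧` with values in degree `n`, as a map into the direct sum. -/
def ofLinP {V : Type*} [AddCommGroup V] [Module k V] (n : ℕ) (f : V →ₗ[k] F.Prolongation)
    (hf : ∀ v, f v ∈ F.grP n) : V →ₗ[k] ⨁ n, F.grP n :=
  DirectSum.lof k ℕ (fun n => F.grP n) n ∘ₗ f.codRestrict (F.grP n) hf

theorem ofLinP_apply {V : Type*} [AddCommGroup V] [Module k V] (n : ℕ)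
    (f : V →ₗ[k] F.Prolongation) (hf : ∀ v, f v ∈ F.grP n) (v : V) :
    F.ofLinP n f hf v = DirectSum.of (fun n => F.grP n) n ⟨f v, hf v⟩ := rfl

theorem dadb_formP_mem (s : H ⊗[k] H) : F.dadb (R := F.Prolongation) F.formP s ∈ F.grP 2 := by
  induction s using TensorProduct.induction_on with
  | zero => simp
  | tmul a b => exact F.grP_mul 1 1 (Submodule.mul_mem_mul (F.formP_mem _) (F.formP_mem _))
  | add x y hx hy => rw [map_add]; exact add_mem hx hy

theorem dadb_ofLinP (s : H ⊗[k] H) :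
    F.dadb (R := ⨁ n, F.grP n) (F.ofLinP 1 F.formP F.formP_mem) s =
      F.ofLinP 2 (F.dadb F.formP) F.dadb_formP_mem s := by
  induction s using TensorProduct.induction_on with
  | zero => rw [map_zero, map_zero]
  | tmul a b =>
    rw [dadb_tmul]
    exact F.ofP_mul _ _ _ rfl rfl
  | add x y hx hy => rw [map_add, map_add, hx, hy]

/-- The decomposition of `Γ^∧` on the degree zero part. -/
def decomposeInclP : H →ₐ[k] ⨁ n, F.grP n :=
  AlgHom.ofLinearMap (F.ofLinP 0 F.inclP.toLinearMap F.inclP_mem)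
    (congrArg (DirectSum.of (fun n => F.grP n) 0) (Subtype.ext (map_one F.inclP)))
    (fun a b => (F.ofP_mul (m := 0) (n := 0) (p := 0) (F.inclP_mem a) (F.inclP_mem b)
      (F.inclP_mem (a * b)) rfl (map_mul F.inclP a b).symm).symm)

/-- The decomposition of `Γ^∧` into its homogeneous parts. -/
def decomposeP : F.Prolongation →ₐ[k] ⨁ n, F.grP n :=
  F.liftP (R := ⨁ n, F.grP n) F.decomposeInclP
    (F.ofLinP 1 F.formP F.formP_mem)
    (fun a γ => (F.ofP_mul (m := 0) (n := 1) (p := 1) (F.inclP_mem a) (F.formP_mem γ)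
      (F.formP_mem (a • γ)) rfl (F.formP_smul a γ).symm).symm)
    (fun a γ => (F.ofP_mul (m := 1) (n := 0) (p := 1) (F.formP_mem γ) (F.inclP_mem a)
      (F.formP_mem (op a • γ)) rfl (F.formP_op_smul a γ).symm).symm)
    (fun t ht => by
      refine (F.dadb_ofLinP t).trans ?_
      have : (⟨F.dadb F.formP t, F.dadb_formP_mem t⟩ : F.grP 2) = 0 :=
        Subtype.ext (F.dadb_formP t ht)
      exact (congrArg (DirectSum.of (fun n => F.grP n) 2) this).trans (map_zero _))

theorem decomposeP_inclP (a : H) : F.decomposeP (F.inclP a) =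
    DirectSum.of (fun n => F.grP n) 0 ⟨F.inclP a, F.inclP_mem a⟩ :=
  F.liftP_inclP (R := ⨁ n, F.grP n) ..

theorem decomposeP_formP (γ : Γ) : F.decomposeP (F.formP γ) =
    DirectSum.of (fun n => F.grP n) 1 ⟨F.formP γ, F.formP_mem γ⟩ :=
  F.liftP_formP (R := ⨁ n, F.grP n) ..

theorem decomposeP_coe (n : ℕ) (x : F.grP n) :
    F.decomposeP x = DirectSum.of (fun n => F.grP n) n x := by
  obtain ⟨x, hx⟩ := x
  have key : ∃ h : x ∈ F.grP n, F.decomposeP x = DirectSum.of (fun n => F.grP n) n ⟨x, h⟩ := by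
    refine F.grP_induction (p := fun n x => ∃ h : x ∈ F.grP n,
      F.decomposeP x = DirectSum.of (fun n => F.grP n) n ⟨x, h⟩) ?_ ?_ ?_ n x hx
    · intro a
      exact ⟨F.inclP_mem a, F.decomposeP_inclP a⟩
    · rintro n x y ⟨hx, ex⟩ ⟨hy, ey⟩
      refine ⟨add_mem hx hy, ?_⟩
      rw [map_add, ex, ey, ← map_add]
      rfl
    · rintro n x γ - ⟨hx, ex⟩
      refine ⟨F.grP_mul n 1 (Submodule.mul_mem_mul hx (F.formP_mem γ)), ?_⟩
      rw [map_mul, ex, decomposeP_formP, DirectSum.of_mul_of]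
      rfl
  exact key.2

instance gradedAlgebraP : GradedAlgebra F.grP :=
  GradedAlgebra.ofAlgHom F.grP F.decomposeP
    (by
      ext x
      induction x using F.inductionP with
      | hi a => simp [decomposeP_inclP]
      | hf γ => simp [decomposeP_formP]
      | hadd x y hx hy => rw [map_add, hx, hy, map_add]
      | hmul x y hx hy => rw [map_mul, hx, hy, map_mul])
    F.decomposeP_coe

theorem signP_of_mem (n : ℕ) (x : F.Prolongation) (hx : x ∈ F.grP n) :
    F.signP x = (-1 : k) ^ n • x := by
  refine F.grP_induction (p := fun n x => F.signP x = (-1 : k) ^ n • x) ?_ ?_ ?_ n x hx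
  · intro a; simp [signP, matrixP_inclP]
  · intro n x y hx hy
    simp only [signP, map_add, Matrix.add_apply] at hx hy ⊢
    rw [hx, hy, smul_add]
  · intro n x γ _ hx
    rw [signP_mul, hx]
    simp [signP, matrixP_formP, pow_succ]

theorem deltaP_mem (γ : Γ) : F.deltaP γ ∈ F.grP 2 := by
  induction γ using F.induction_form with
  | h a b =>
    rw [deltaP_smul_d]
    exact F.grP_mul 1 1 (Submodule.mul_mem_mul (F.formP_mem _) (F.formP_mem _))
  | h0 => simp
  | hadd x y hx hy => rw [map_add]; exact add_mem hx hy

theorem dP_mem (n : ℕ) (x : F.Prolongation) (hx : x ∈ F.grP n) : F.dP x ∈ F.grP (n + 1) := by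
  refine F.grP_induction (p := fun n x => F.dP x ∈ F.grP (n + 1)) ?_ ?_ ?_ n x hx
  · intro a; rw [dP_inclP]; exact F.formP_mem _
  · intro n x y hx hy; rw [map_add]; exact add_mem hx hy
  · intro n x γ hx hdx
    rw [dP_mul, dP_formP, F.signP_of_mem n x hx]
    exact add_mem (F.grP_mul (n + 1) 1 (Submodule.mul_mem_mul hdx (F.formP_mem γ)))
      (F.grP_mul n 2 (Submodule.mul_mem_mul (Submodule.smul_mem _ _ hx) (F.deltaP_mem γ)))

theorem dP_dP (x : F.Prolongation) : F.dP (F.dP x) = 0 := by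
  have hom : ∀ n x, x ∈ F.grP n → F.dP (F.dP x) = 0 := by
    refine F.grP_induction (p := fun _ x => F.dP (F.dP x) = 0) ?_ ?_ ?_
    · intro a; rw [dP_inclP, dP_formP, deltaP_d]
    · intro n x y hx hy; rw [map_add, map_add, hx, hy, add_zero]
    · intro n x γ hx hdx
      rw [dP_mul, dP_formP, F.signP_of_mem n x hx, map_add, dP_mul, hdx,
        F.signP_of_mem (n + 1) _ (F.dP_mem n x hx), dP_formP, smul_mul_assoc, smul_mul_assoc,
        map_smul, dP_mul, dP_deltaP, pow_succ]
      simp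
  induction x using DirectSum.Decomposition.inductionOn F.grP with
  | zero => simp
  | homogeneous x => exact hom _ _ x.2
  | add x y hx hy => rw [map_add, map_add, hx, hy, add_zero]

theorem inclP_injective : Function.Injective F.inclP := by
  have h : Function.LeftInverse
      (F.liftP (AlgHom.id k H) 0 (by simp) (by simp) (fun t _ => by
        have : F.dadb (0 : Γ →ₗ[k] H) = 0 := by ext a b; simp
        rw [this]; rfl)) F.inclP := fun a => by simp
  exact h.injective

theorem grP_eq_span (n : ℕ) : F.grP n = Submodule.span k
    {ω | ∃ (a₀ : H) (a : Fin n → H),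
      ω = F.inclP a₀ * (List.ofFn fun i => F.dP (F.inclP (a i))).prod} := by
  apply le_antisymm
  · induction n with
    | zero =>
      rw [grP_zero]
      rintro _ ⟨a, rfl⟩
      exact Submodule.subset_span ⟨a, Fin.elim0, by simp⟩
    | succ n ih =>
      -- move the coefficient of the last one-form to the left
      have hG : LinearMap.range F.formP ≤
          LinearMap.range F.inclP.toLinearMap * LinearMap.range (F.formP ∘ₗ F.d) := by
        rintro _ ⟨γ, rfl⟩
        induction γ using F.induction_form with
        | h a b => rw [formP_smul]; exact Submodule.mul_mem_mul ⟨a, rfl⟩ ⟨b, rfl⟩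
        | h0 => simp
        | hadd x y hx hy => rw [map_add]; exact add_mem hx hy
      have h1 : F.grP (n + 1) ≤ F.grP n * LinearMap.range (F.formP ∘ₗ F.d) := by
        calc F.grP (n + 1) = F.grP n * LinearMap.range F.formP := F.grP_succ n
          _ ≤ F.grP n * (F.grP 0 * LinearMap.range (F.formP ∘ₗ F.d)) := by
              rw [grP_zero]; exact mul_le_mul' le_rfl hG
          _ = F.grP n * F.grP 0 * LinearMap.range (F.formP ∘ₗ F.d) := (mul_assoc _ _ _).symm
          _ ≤ _ := mul_le_mul' (F.grP_mul n 0) le_rfl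
      refine h1.trans ((mul_le_mul' ih le_rfl).trans ?_)
      rw [Submodule.mul_le]
      rintro x hx _ ⟨b, rfl⟩
      induction hx using Submodule.span_induction with
      | mem x hx =>
        obtain ⟨a₀, a, rfl⟩ := hx
        refine Submodule.subset_span ⟨a₀, Fin.snoc a b, ?_⟩
        rw [List.ofFn_succ', List.concat_eq_append, List.prod_append]
        simp [mul_assoc, dP_inclP]
      | zero => simp
      | add x y _ _ hx hy => rw [add_mul]; exact add_mem hx hy
      | smul c x _ hx => rw [smul_mul_assoc]; exact Submodule.smul_mem _ _ hx
  · rw [Submodule.span_le]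
    rintro _ ⟨a₀, a, rfl⟩
    have : ∀ (l : List H), (l.map fun b => F.dP (F.inclP b)).prod ∈ F.grP l.length := by
      intro l
      induction l with
      | nil => simpa using F.inclP_mem 1
      | cons b l ih =>
        rw [List.map_cons, List.prod_cons, dP_inclP, List.length_cons, add_comm]
        exact F.grP_mul 1 _ (Submodule.mul_mem_mul (F.formP_mem _) ih)
    have h2 := this (List.ofFn a)
    rw [List.map_ofFn, List.length_ofFn] at h2
    have h3 := F.grP_mul 0 n (Submodule.mul_mem_mul (F.inclP_mem a₀) h2)
    rw [zero_add] at h3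
    exact h3

/-- The maximal prolongation `Γ^∧` of `(Γ, d)`, a differential calculus on `H`. -/
def prolongation : DifferentialCalculus k H F.Prolongation where
  gr := F.grP
  d := F.dP
  d_mem := F.dP_mem
  d_d := F.dP_dP
  leibniz n x y hx := by rw [dP_mul, F.signP_of_mem n x hx, smul_mul_assoc]
  incl := F.inclP
  incl_injective := F.inclP_injective
  range_incl := F.grP_zero.symm
  gr_eq_span := F.grP_eq_span

end Prolongation

/-! ### Covariance -/

section Covariance

variable {k H Γ : Type*} [Field k] [Ring H] [HopfAlgebra k H]
  [AddCommGroup Γ] [Module k Γ] [Module H Γ] [Module Hᵐᵒᵖ Γ] [SMulCommClass H Hᵐᵒᵖ Γ]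
  [IsScalarTower k H Γ] [IsScalarTower k Hᵐᵒᵖ Γ]

/-- `(Γ, d)` is left covariant: there is a left coaction `Γ → H ⊗ Γ` which is compatible with the
bimodule structure and for which `d` is colinear. -/
def IsLeftCovariant (F : FirstOrderCalculus k H Γ) : Prop :=
  ∃ δ : Γ →ₗ[k] H ⊗[k] Γ,
    (TensorProduct.map LinearMap.id δ ∘ₗ δ =
      (TensorProduct.assoc k H H Γ).toLinearMap ∘ₗ
        TensorProduct.map Coalgebra.comul LinearMap.id ∘ₗ δ) ∧
    (∀ γ, TensorProduct.lid k Γ (TensorProduct.map Coalgebra.counit LinearMap.id (δ γ)) = γ) ∧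
    (∀ (a : H) (γ : Γ), δ (a • γ) =
      TensorProduct.map₂ (LinearMap.mul k H) (leftAct k H Γ) (Coalgebra.comul (R := k) a) (δ γ)) ∧
    (∀ (a : H) (γ : Γ), δ (op a • γ) =
      TensorProduct.map₂ (LinearMap.mul k H).flip (rightAct k H Γ)
        (Coalgebra.comul (R := k) a) (δ γ)) ∧
    (δ ∘ₗ F.d = TensorProduct.map LinearMap.id F.d ∘ₗ Coalgebra.comul)

/-- `(Γ, d)` is right covariant: there is a right coaction `Γ → Γ ⊗ H` which is compatible with
the bimodule structure and for which `d` is colinear. -/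
def IsRightCovariant (F : FirstOrderCalculus k H Γ) : Prop :=
  ∃ δ : Γ →ₗ[k] Γ ⊗[k] H,
    ((TensorProduct.assoc k Γ H H).toLinearMap ∘ₗ TensorProduct.map δ LinearMap.id ∘ₗ δ =
      TensorProduct.map LinearMap.id Coalgebra.comul ∘ₗ δ) ∧
    (∀ γ, TensorProduct.rid k Γ (TensorProduct.map LinearMap.id Coalgebra.counit (δ γ)) = γ) ∧
    (∀ (a : H) (γ : Γ), δ (a • γ) =
      TensorProduct.map₂ (leftAct k H Γ) (LinearMap.mul k H) (Coalgebra.comul (R := k) a) (δ γ)) ∧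
    (∀ (a : H) (γ : Γ), δ (op a • γ) =
      TensorProduct.map₂ (rightAct k H Γ) (LinearMap.mul k H).flip
        (Coalgebra.comul (R := k) a) (δ γ)) ∧
    (δ ∘ₗ F.d = TensorProduct.map F.d LinearMap.id ∘ₗ Coalgebra.comul)

/-- `(Γ, d)` is bicovariant. -/
def IsBicovariant (F : FirstOrderCalculus k H Γ) : Prop := F.IsLeftCovariant ∧ F.IsRightCovariant

end Covariance

end FirstOrderCalculus

/-! ### Quantum principal bundles -/

section Balanced

variable (R : Type*) [Ring R]

/-- The subgroup of `X ⊗_ℤ M` generated by the elements `x r ⊗ m - x ⊗ r m`. -/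
def balancing (X M : Type*) [AddCommGroup X] [Module Rᵐᵒᵖ X] [AddCommGroup M] [Module R M] :
    AddSubgroup (X ⊗[ℤ] M) :=
  AddSubgroup.closure {t | ∃ (x : X) (r : R) (m : M), t = (op r • x) ⊗ₜ m - x ⊗ₜ (r • m)}

/-- The balanced tensor product `X ⊗_R M` of a right and a left module over a (possibly
noncommutative) ring. -/
abbrev BalancedTensor (X M : Type*) [AddCommGroup X] [Module Rᵐᵒᵖ X] [AddCommGroup M]
    [Module R M] : Type _ :=
  (X ⊗[ℤ] M) ⧸ balancing R X M

variable {R}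

/-- The map `f ⊗_R id` induced by a map `f` of right `R`-modules. -/
def BalancedTensor.map {X Y : Type*} (M : Type*) [AddCommGroup X] [Module Rᵐᵒᵖ X] [AddCommGroup Y]
    [Module Rᵐᵒᵖ Y] [AddCommGroup M] [Module R M] (f : X →ₗ[Rᵐᵒᵖ] Y) :
    BalancedTensor R X M →+ BalancedTensor R Y M :=
  QuotientAddGroup.map _ _
    (TensorProduct.map f.toAddMonoidHom.toIntLinearMap LinearMap.id).toAddMonoidHom (by
    rw [balancing, AddSubgroup.closure_le]
    rintro _ ⟨x, r, m, rfl⟩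
    refine AddSubgroup.subset_closure ⟨f x, r, m, ?_⟩
    refine (map_sub _ _ _).trans ?_
    exact congrArg₂ _ (congrArg (fun y => y ⊗ₜ[ℤ] m) (map_smul f (op r) x)) rfl)

/-- `0 → X → Y → Z → 0` is exact. -/
def IsShortExact {X Y Z : Type*} [Zero Z] (f : X → Y) (g : Y → Z) : Prop :=
  Function.Injective f ∧ Function.Exact f g ∧ Function.Surjective g

/-- A left `R`-module `M` is faithfully flat if a sequence `0 → X → Y → Z → 0` of right
`R`-modules is exact if and only if `0 → X ⊗_R M → Y ⊗_R M → Z ⊗_R M → 0` is. -/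
def IsFaithfullyFlat (R M : Type u) [Ring R] [AddCommGroup M] [Module R M] : Prop :=
  ∀ (X Y Z : Type u) [AddCommGroup X] [Module Rᵐᵒᵖ X] [AddCommGroup Y] [Module Rᵐᵒᵖ Y]
    [AddCommGroup Z] [Module Rᵐᵒᵖ Z] (f : X →ₗ[Rᵐᵒᵖ] Y) (g : Y →ₗ[Rᵐᵒᵖ] Z),
    IsShortExact f g ↔ IsShortExact (BalancedTensor.map M f) (BalancedTensor.map M g)

end Balanced

/-- A right `H`-comodule algebra structure on `A`: a coassociative and counital algebra map
`Δ_A : A → A ⊗ H`. -/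
structure ComoduleAlgebra (k H A : Type*) [Field k] [Ring H] [HopfAlgebra k H] [Ring A]
    [Algebra k A] where
  coaction : A →ₐ[k] A ⊗[k] H
  coassoc : (TensorProduct.assoc k A H H).toLinearMap ∘ₗ
      TensorProduct.map coaction.toLinearMap LinearMap.id ∘ₗ coaction.toLinearMap =
    TensorProduct.map LinearMap.id Coalgebra.comul ∘ₗ coaction.toLinearMap
  counit : ∀ a, TensorProduct.rid k A
    (TensorProduct.map LinearMap.id Coalgebra.counit (coaction a)) = a

namespace ComoduleAlgebra

variable {k H : Type*} {A : Type u} [Field k] [Ring H] [HopfAlgebra k H] [Ring A] [Algebra k A]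

/-- The subalgebra `B = A^{co H}` of coinvariant elements. -/
def coinvariants (P : ComoduleAlgebra k H A) : Subalgebra k A :=
  AlgHom.equalizer P.coaction Algebra.TensorProduct.includeLeft

/-- `A` as a right module over a subalgebra `B`, by right multiplication. -/
instance rightModule (B : Subalgebra k A) : Module Bᵐᵒᵖ A :=
  Module.compHom A (RingHom.op B.val.toRingHom)

theorem rightModule_smul (B : Subalgebra k A) (b : B) (a : A) : op b • a = a * (b : A) := rfl

/-- The canonical map `χ : A ⊗_B A → A ⊗ H`, `a ⊗ a' ↦ (a ⊗ 1) Δ_A(a')`, where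
`B = A^{co H}`. -/
def canonicalMap (P : ComoduleAlgebra k H A) :
    BalancedTensor P.coinvariants A A →+ A ⊗[k] H :=
  QuotientAddGroup.lift _
    (TensorProduct.liftAddHom
      ((AddMonoidHom.mul.compl₂ P.coaction.toRingHom.toAddMonoidHom).comp
        (Algebra.TensorProduct.includeLeft : A →ₐ[k] A ⊗[k] H).toRingHom.toAddMonoidHom)
      (fun n a a' => by rw [map_zsmul, map_zsmul]; rfl))
    (by
      rw [balancing, AddSubgroup.closure_le]
      rintro _ ⟨x, b, m, rfl⟩
      have hb : P.coaction (b : A) = (b : A) ⊗ₜ 1 := b.2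
      refine (map_sub _ _ _).trans ?_
      change (x * (b : A)) ⊗ₜ[k] (1 : H) * P.coaction m - x ⊗ₜ[k] (1 : H) * P.coaction (b * m) = 0
      rw [map_mul, hb, ← mul_assoc, Algebra.TensorProduct.tmul_mul_tmul, one_mul, sub_self])

/-- `A^{co H} ⊆ A` is a quantum principal bundle: a faithfully flat Hopf-Galois extension. -/
structure IsQuantumPrincipalBundle (P : ComoduleAlgebra k H A) : Prop where
  galois : Function.Bijective P.canonicalMap
  faithfullyFlat : IsFaithfullyFlat P.coinvariants A

end ComoduleAlgebra

/-! ### Complete calculi, horizontal forms and base space forms -/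

/-- A complete differential calculus over `A`, with respect to a first order calculus `(Γ, d)` on
`H` and its maximal prolongation `Ω(H) = Γ^∧`: a differential calculus `Ω` on `A` such that the
coaction `Δ_A` extends to a morphism `Δ_A^∧ : Ω → Ω ⊗ Ω(H)` of differential graded algebras. -/
structure CompleteCalculus {k H Γ A : Type*} [Field k] [Ring H] [HopfAlgebra k H]
    [AddCommGroup Γ] [Module k Γ] [Module H Γ] [Module Hᵐᵒᵖ Γ] [SMulCommClass H Hᵐᵒᵖ Γ]
    [IsScalarTower k H Γ] [IsScalarTower k Hᵐᵒᵖ Γ] [Ring A] [Algebra k A]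
    (P : ComoduleAlgebra k H A) (F : FirstOrderCalculus k H Γ)
    (Ω : Type*) [Ring Ω] [Algebra k Ω] extends DifferentialCalculus k A Ω where
  coact : Ω →ₐ[k] toDGAlgebra.Tensor F.prolongation.toDGAlgebra
  isMorphism : toDGAlgebra.IsTensorMorphism F.prolongation.toDGAlgebra coact
  coact_incl : ∀ a : A, coact (incl a) = GradedTensorProduct.of k gr F.prolongation.gr
    (TensorProduct.map incl.toLinearMap F.prolongation.incl.toLinearMap (P.coaction a))

namespace CompleteCalculus

variable {k H Γ A Ω : Type*} [Field k] [Ring H] [HopfAlgebra k H]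
  [AddCommGroup Γ] [Module k Γ] [Module H Γ] [Module Hᵐᵒᵖ Γ] [SMulCommClass H Hᵐᵒᵖ Γ]
  [IsScalarTower k H Γ] [IsScalarTower k Hᵐᵒᵖ Γ] [Ring A] [Algebra k A] [Ring Ω] [Algebra k Ω]
  {P : ComoduleAlgebra k H A} {F : FirstOrderCalculus k H Γ}

/-- `Δ_A^∧` as a linear map into the plain tensor product `Ω(A) ⊗ Ω(H)`. -/
def coactLin (C : CompleteCalculus P F Ω) : Ω →ₗ[k] Ω ⊗[k] F.Prolongation :=
  (GradedTensorProduct.of k C.gr F.prolongation.gr).symm.toLinearMap ∘ₗ C.coact.toLinearMap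

/-- The horizontal forms `(Δ_A^∧)⁻¹(Ω(A) ⊗ H)`. -/
def horizontal (C : CompleteCalculus P F Ω) : Submodule k Ω :=
  (LinearMap.range (TensorProduct.map (LinearMap.id : Ω →ₗ[k] Ω)
    F.prolongation.incl.toLinearMap)).comap C.coactLin

/-- The base space forms `{ω | Δ_A^∧(ω) = ω ⊗ 1}`. -/
def baseForms (C : CompleteCalculus P F Ω) : Submodule k Ω :=
  LinearMap.eqLocus C.coactLin ((TensorProduct.mk k Ω F.Prolongation).flip 1)

/-- The right coaction `(id ⊗ π₀) Δ_A^∧ : Ω(A) → Ω(A) ⊗ H` on forms. -/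
def rightCoaction (C : CompleteCalculus P F Ω) : Ω →ₗ[k] Ω ⊗[k] H :=
  TensorProduct.map LinearMap.id F.prolongation.projZero ∘ₗ C.coactLin

/-- The right `H`-coinvariant forms `Ω(A)^{co H}`. -/
def coinvariantForms (C : CompleteCalculus P F Ω) : Submodule k Ω :=
  LinearMap.eqLocus C.rightCoaction ((TensorProduct.mk k Ω H).flip 1)

end CompleteCalculus

end QuantumBundle

end

open scoped TensorProduct

/-! Write Δ for the coaction on forms. A form x is horizontal exactly when Δx comes from some t in
Ω(A) ⊗ H, and since π₀ is a retraction of the inclusion of H, this t is the right coaction of x. For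
horizontal forms, coinvariance and Δx = x ⊗ 1 are therefore the same equation, which gives the first
assertion.

For the second, one inclusion holds because d1 = 0: then Δx = x ⊗ 1 forces Δ(dx) = dx ⊗ 1, so both x
and dx are horizontal. Conversely let x be horizontal with Δx = ∑ xᵢ ⊗ hᵢ. Since Δ is a morphism of
differential graded algebras, Δ(dx) = ∑ dxᵢ ⊗ hᵢ + ∑ ±xᵢ ⊗ dhᵢ, the sign being that of the degree in
the first factor. If dx is horizontal too, the second sum has to vanish, as it lies in Ω(A) ⊗ Γ. The
degree involution is bijective, so the signs can be removed, and (id ⊗ d)t = 0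
(`lTensor_d_eq_zero`).

Connectedness says that k → H → Γ is exact. Tensoring over a field keeps it exact, hence t = y ⊗ 1
for some y in Ω(A). Here the differential of the prolongation takes the place of d : H → Γ, so Γ
must embed in Γ^∧ (`formP_injective`).

It remains to see that y = x, which is the counit axiom for Δ (`slice_coact`). The counit of H,
extended by zero to positive degrees, is a character of Ω(H), and id ⊗ ε is an algebra map on the
graded tensor product that commutes with the differentials. The composite (id ⊗ ε)Δ then fixes A and
commutes with d, so it is the identity on everything that A and dA generate. -/

namespace QuantumBundle

/-! ### Degree involution and slice maps on graded tensor products -/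

namespace DGAlgebra

variable {k Ω Ω' : Type*} [Field k] [Ring Ω] [Algebra k Ω] [Ring Ω'] [Algebra k Ω']

theorem degreeInvolution_of_mem (C : DGAlgebra k Ω) {n : ℕ} {x : Ω} (hx : x ∈ C.gr n) :
    C.degreeInvolution x = (-1 : k) ^ n • x := by
  lift x to C.gr n using hx
  rw [degreeInvolution, LinearMap.comp_apply, LinearEquiv.coe_coe,
    DirectSum.decomposeLinearEquiv_apply, DirectSum.decompose_coe,
    ← DirectSum.lof_eq_of k, DirectSum.toModule_lof]
  rfl

theorem induction_homogeneous (C : DGAlgebra k Ω) {p : Ω → Prop}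
    (h : ∀ n, ∀ x ∈ C.gr n, p x) (hadd : ∀ x y, p x → p y → p (x + y)) (x : Ω) : p x :=
  -- No separate zero case is needed, because 0 is homogeneous of degree 0.
  DirectSum.Decomposition.inductionOn C.gr (h 0 0 (zero_mem _)) (fun {i} m => h i m m.2) hadd x

/-- The sign (-1)^n squares to 1. This is what allows the sign in the differential of a tensor
product to be undone. -/
theorem degreeInvolution_degreeInvolution (C : DGAlgebra k Ω) (x : Ω) :
    C.degreeInvolution (C.degreeInvolution x) = x := by
  induction x using C.induction_homogeneous with
  | h n x hx =>
    rw [C.degreeInvolution_of_mem hx, map_smul, C.degreeInvolution_of_mem hx, smul_smul,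
      ← mul_pow]
    simp
  | hadd x y hx hy => rw [map_add, map_add, hx, hy]

/-- The tensor product `id ⊗ e` of the identity with a character `e` that vanishes in positive
degrees, an algebra map on the graded tensor product. -/
noncomputable def slice (C : DGAlgebra k Ω) (D : DGAlgebra k Ω') (e : Ω' →ₐ[k] k)
    (he : ∀ n, ∀ y ∈ D.gr (n + 1), e y = 0) : C.Tensor D →ₐ[k] Ω :=
  GradedTensorProduct.lift C.gr D.gr (AlgHom.id k Ω) ((Algebra.ofId k Ω).comp e) (by
    -- The images of the two factors must commute up to the sign (-1)^(ij). In degree 0 of the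
    -- second factor the sign is trivial and the values of `e` are central scalars; in positive
    -- degree both sides vanish by `he`.
    rintro i (_ | j) a b
    · simpa using (Algebra.commutes (e b) (a : Ω)).symm
    · simp [he j b b.2])

theorem slice_of (C : DGAlgebra k Ω) (D : DGAlgebra k Ω') (e : Ω' →ₐ[k] k)
    (he : ∀ n, ∀ y ∈ D.gr (n + 1), e y = 0) (t : Ω ⊗[k] Ω') :
    C.slice D e he (GradedTensorProduct.of k C.gr D.gr t) =
      TensorProduct.rid k Ω (TensorProduct.map LinearMap.id e.toLinearMap t) := by
  induction t using TensorProduct.induction_on with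
  | zero => simp
  | tmul x y =>
    refine (GradedTensorProduct.lift_tmul C.gr D.gr _ _ _ x y).trans ?_
    simp [Algebra.ofId_apply, Algebra.smul_def, Algebra.commutes]
  | add x y hx hy => simp only [map_add, hx, hy]

/-- The differential of the second factor lands in positive degrees, where `e` vanishes, so only the
term da ⊗ b survives the slice. -/
theorem slice_tensorD (C : DGAlgebra k Ω) (D : DGAlgebra k Ω') (e : Ω' →ₐ[k] k)
    (he : ∀ n, ∀ y ∈ D.gr (n + 1), e y = 0) (t : C.Tensor D) :
    C.slice D e he (C.tensorD D t) = C.d (C.slice D e he t) := by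
  have hd : ∀ y, e (D.d y) = 0 := fun y => by
    induction y using D.induction_homogeneous with
    | h n y hy => exact he n _ (D.d_mem n y hy)
    | hadd x y hx hy => rw [map_add, map_add, hx, hy, add_zero]
  obtain ⟨t, rfl⟩ := (GradedTensorProduct.of k C.gr D.gr).surjective t
  rw [tensorD, LinearMap.comp_apply, LinearMap.comp_apply, LinearEquiv.coe_coe,
    LinearEquiv.coe_coe, GradedTensorProduct.of_symm_of, slice_of, slice_of]
  induction t using TensorProduct.induction_on with
  | zero => simp
  | tmul x y => simp [hd]
  | add x y hx hy => simp only [map_add, hx, hy]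

end DGAlgebra

/-! ### Degree-zero projection and generators of a differential calculus -/

namespace DifferentialCalculus

variable {k A Ω : Type*} [Field k] [Ring A] [Algebra k A] [Ring Ω] [Algebra k Ω]

theorem incl_mem (C : DifferentialCalculus k A Ω) (a : A) : C.incl a ∈ C.gr 0 :=
  C.range_incl ▸ ⟨a, rfl⟩

theorem projZero_incl (C : DifferentialCalculus k A Ω) (a : A) : C.projZero (C.incl a) = a := by
  have h : DirectSum.component k ℕ (fun n => C.gr n) 0
      (DirectSum.decomposeLinearEquiv C.gr (C.incl a)) = ⟨C.incl a, C.incl_mem a⟩ := by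
    rw [DirectSum.decomposeLinearEquiv_apply,
      DirectSum.decompose_of_mem C.gr (C.incl_mem a), ← DirectSum.lof_eq_of k,
      DirectSum.component.lof_self]
  rw [projZero, LinearMap.comp_apply, LinearMap.comp_apply, LinearEquiv.coe_coe,
    LinearEquiv.coe_coe, h, LinearEquiv.symm_apply_eq]
  rfl

theorem projZero_of_mem_succ (C : DifferentialCalculus k A Ω) {n : ℕ} {x : Ω}
    (hx : x ∈ C.gr (n + 1)) : C.projZero x = 0 := by
  have h : DirectSum.component k ℕ (fun n => C.gr n) 0
      (DirectSum.decomposeLinearEquiv C.gr x) = 0 := by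
    rw [DirectSum.decomposeLinearEquiv_apply, DirectSum.decompose_of_mem C.gr hx]
    exact DirectSum.of_eq_of_ne (β := fun n => C.gr n) (n + 1) 0 ⟨x, hx⟩ n.succ_ne_zero.symm
  rw [projZero, LinearMap.comp_apply, LinearMap.comp_apply, LinearEquiv.coe_coe,
    LinearEquiv.coe_coe, h, map_zero]

/-- A differential calculus is generated by its degree zero part and the differential. -/
theorem induction_generators (C : DifferentialCalculus k A Ω) {p : Ω → Prop}
    (hi : ∀ a, p (C.incl a)) (hd : ∀ a, p (C.d (C.incl a)))
    (hadd : ∀ x y, p x → p y → p (x + y)) (hmul : ∀ x y, p x → p y → p (x * y)) (x : Ω) :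
    p x := by
  have hprod : ∀ l : List Ω, (∀ y ∈ l, p y) → p l.prod := fun l => by
    induction l with
    | nil => intro _; simpa using hi 1
    | cons y l ih =>
      intro h
      rw [List.prod_cons]
      exact hmul _ _ (h y (by simp)) (ih fun z hz => h z (by simp [hz]))
  induction x using C.induction_homogeneous with
  | h n x hx =>
    rw [C.gr_eq_span] at hx
    induction hx using Submodule.span_induction with
    | mem x hx =>
      obtain ⟨a₀, a, rfl⟩ := hx
      refine hmul _ _ (hi a₀) (hprod _ fun y hy => ?_)
      obtain ⟨i, rfl⟩ := (List.mem_ofFn' _ _).1 hy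
      exact hd (a i)
    | zero => simpa using hi 0
    | add x y _ _ hx hy => exact hadd x y hx hy
    | smul c x _ hx =>
      -- Scalars lie in the image of A, so scaling is multiplication by a generator.
      rw [Algebra.smul_def, ← C.incl.commutes]
      exact hmul _ _ (hi _) hx
  | hadd x y hx hy => exact hadd x y hx hy

end DifferentialCalculus

/-! ### One-forms and the counit in the maximal prolongation -/

namespace FirstOrderCalculus

variable {k H Γ : Type*} [Field k] [AddCommGroup Γ] [Module k Γ]

/-- The relations of the prolongation beyond the bimodule structure are sums of products of two
one-forms. All such products vanish in the square-zero extension H ⊕ Γ, so Γ^∧ maps onto this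
algebra, and there Γ visibly embeds. -/
theorem formP_injective [Ring H] [Algebra k H] [Module H Γ] [Module Hᵐᵒᵖ Γ]
    [SMulCommClass H Hᵐᵒᵖ Γ] [IsScalarTower k H Γ] [IsScalarTower k Hᵐᵒᵖ Γ]
    (F : FirstOrderCalculus k H Γ) : Function.Injective F.formP := by
  let g : Γ →ₗ[k] TrivSqZeroExt H Γ := TrivSqZeroExt.inrHom H Γ |>.restrictScalars k
  have hg : ∀ γ, g γ = TrivSqZeroExt.inr γ := fun _ => rfl
  have hd : F.dadb g = 0 := by
    refine TensorProduct.ext' fun a b => ?_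
    rw [dadb_tmul, hg, hg, TrivSqZeroExt.inr_mul_inr, LinearMap.zero_apply]
  let φ := F.liftP (TrivSqZeroExt.inlAlgHom k H Γ) g (fun a γ => (TrivSqZeroExt.inl_mul_inr a γ).symm)
    (fun a γ => (TrivSqZeroExt.inr_mul_inl a γ).symm) (by intro t _; rw [hd]; rfl)
  have hφ : ∀ γ, φ (F.formP γ) = TrivSqZeroExt.inr γ := fun γ => F.liftP_formP ..
  intro γ γ' h
  exact TrivSqZeroExt.inr_injective (R := H) ((hφ γ).symm.trans ((congrArg φ h).trans (hφ γ')))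

variable [Ring H] [HopfAlgebra k H] [Module H Γ] [Module Hᵐᵒᵖ Γ]
  [SMulCommClass H Hᵐᵒᵖ Γ] [IsScalarTower k H Γ] [IsScalarTower k Hᵐᵒᵖ Γ]

/-- The counit of `H` extended by zero to the forms of positive degree. -/
noncomputable def counitP (F : FirstOrderCalculus k H Γ) : F.Prolongation →ₐ[k] k :=
  F.liftP (Bialgebra.counitAlgHom k H) 0 (by simp) (by simp) (fun t _ => by
    have : F.dadb (0 : Γ →ₗ[k] k) = 0 := by ext; simp
    rw [this, LinearMap.zero_apply])

theorem counitP_inclP (F : FirstOrderCalculus k H Γ) (a : H) :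
    F.counitP (F.inclP a) = Coalgebra.counit (R := k) a :=
  F.liftP_inclP ..

theorem counitP_of_mem_succ (F : FirstOrderCalculus k H Γ) (n : ℕ) (x : F.Prolongation)
    (hx : x ∈ F.prolongation.gr (n + 1)) : F.counitP x = 0 := by
  change x ∈ F.grP (n + 1) at hx
  rw [grP_succ] at hx
  induction hx using Submodule.mul_induction_on' with
  | mem_mul_mem y _ z hz =>
    obtain ⟨γ, rfl⟩ := hz
    have : F.counitP (F.formP γ) = 0 := F.liftP_formP ..
    rw [map_mul, this, mul_zero]
  | add y _ z _ hy hz => rw [map_add, hy, hz, add_zero]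

end FirstOrderCalculus

/-! ### The coaction on forms, horizontal forms and base forms -/

namespace CompleteCalculus

variable {k H Γ A Ω : Type*} [Field k] [Ring H] [HopfAlgebra k H]
  [AddCommGroup Γ] [Module k Γ] [Module H Γ] [Module Hᵐᵒᵖ Γ] [SMulCommClass H Hᵐᵒᵖ Γ]
  [IsScalarTower k H Γ] [IsScalarTower k Hᵐᵒᵖ Γ] [Ring A] [Algebra k A] [Ring Ω] [Algebra k Ω]
  {P : ComoduleAlgebra k H A} {F : FirstOrderCalculus k H Γ}

/-- Both sides are algebra maps in x that commute with d. They agree on A by the counit axiom of the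
comodule algebra, hence on dA, and these generate all forms. -/
theorem slice_coact (C : CompleteCalculus P F Ω) (x : Ω) :
    C.slice F.prolongation.toDGAlgebra F.counitP F.counitP_of_mem_succ (C.coact x) = x := by
  have hincl : ∀ a, C.slice F.prolongation.toDGAlgebra F.counitP F.counitP_of_mem_succ
      (C.coact (C.incl a)) = C.incl a := fun a => by
    rw [C.coact_incl, DGAlgebra.slice_of]
    have h : ∀ t : A ⊗[k] H, TensorProduct.rid k Ω (TensorProduct.map LinearMap.id
        F.counitP.toLinearMap (TensorProduct.map C.incl.toLinearMap
          F.prolongation.incl.toLinearMap t)) =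
        C.incl (TensorProduct.rid k A (TensorProduct.map LinearMap.id Coalgebra.counit t)) := by
      intro t
      induction t using TensorProduct.induction_on with
      | zero => simp
      | tmul a h =>
        have : F.counitP (F.prolongation.incl h) = Coalgebra.counit (R := k) h :=
          F.counitP_inclP h
        simp [this]
      | add x y hx hy => simp only [map_add, hx, hy]
    rw [h, P.counit]
  induction x using C.induction_generators with
  | hi a => exact hincl a
  | hd a => rw [C.isMorphism.map_d, DGAlgebra.slice_tensorD, hincl]
  | hadd x y hx hy => rw [map_add, map_add, hx, hy]
  | hmul x y hx hy => rw [map_mul, map_mul, hx, hy]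

/-- The counit of `H` is a counit for the coaction on forms. -/
theorem rid_counitP_coactLin (C : CompleteCalculus P F Ω) (x : Ω) :
    TensorProduct.rid k Ω (TensorProduct.map LinearMap.id F.counitP.toLinearMap (C.coactLin x)) =
      x := by
  rw [← C.slice_of F.prolongation.toDGAlgebra F.counitP F.counitP_of_mem_succ]
  exact C.slice_coact x

/-- The compatibility of Δ with d, transported to the plain tensor product, where slicing by linear
maps needs no signs. -/
theorem coactLin_d (C : CompleteCalculus P F Ω) (x : Ω) :
    C.coactLin (C.d x) = TensorProduct.map C.d LinearMap.id (C.coactLin x) +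
      TensorProduct.map C.degreeInvolution F.prolongation.d (C.coactLin x) :=
  congrArg (GradedTensorProduct.of k C.gr F.prolongation.gr).symm (C.isMorphism.map_d x)

theorem mem_baseForms (C : CompleteCalculus P F Ω) {x : Ω} :
    x ∈ C.baseForms ↔ C.coactLin x = x ⊗ₜ 1 := Iff.rfl

theorem mem_coinvariantForms (C : CompleteCalculus P F Ω) {x : Ω} :
    x ∈ C.coinvariantForms ↔ C.rightCoaction x = x ⊗ₜ 1 := Iff.rfl

theorem mem_horizontal (C : CompleteCalculus P F Ω) {x : Ω} :
    x ∈ C.horizontal ↔ ∃ t : Ω ⊗[k] H, TensorProduct.map (LinearMap.id : Ω →ₗ[k] Ω)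
      F.prolongation.incl.toLinearMap t = C.coactLin x := Iff.rfl

/-- Consequently the element of Ω ⊗ H that witnesses horizontality of a form is unique and equals
its right coaction. -/
theorem map_projZero_map_incl (t : Ω ⊗[k] H) :
    TensorProduct.map (LinearMap.id : Ω →ₗ[k] Ω) F.prolongation.projZero
      (TensorProduct.map LinearMap.id F.prolongation.incl.toLinearMap t) = t := by
  induction t using TensorProduct.induction_on with
  | zero => simp
  | tmul x h => simp [DifferentialCalculus.projZero_incl]
  | add x y hx hy => simp only [map_add, hx, hy]

theorem baseForms_le_horizontal (C : CompleteCalculus P F Ω) : C.baseForms ≤ C.horizontal := by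
  intro x hx
  exact C.mem_horizontal.2 ⟨x ⊗ₜ 1, by simp [C.mem_baseForms.1 hx]⟩

/-- On a horizontal form, passing from Δ to the right coaction loses nothing, since π₀ is inverse to
the inclusion on the part Ω ⊗ H; and π₀ takes 1 to 1. -/
theorem baseForms_eq_horizontal_inf_coinvariantForms (C : CompleteCalculus P F Ω) :
    C.baseForms = C.horizontal ⊓ C.coinvariantForms := by
  ext x
  constructor
  · intro hx
    refine ⟨C.baseForms_le_horizontal hx, C.mem_coinvariantForms.2 ?_⟩
    rw [rightCoaction, LinearMap.comp_apply, C.mem_baseForms.1 hx, TensorProduct.map_tmul,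
      ← map_one F.prolongation.incl, DifferentialCalculus.projZero_incl, LinearMap.id_apply]
  · rintro ⟨hx, hc⟩
    obtain ⟨t, ht⟩ := C.mem_horizontal.1 hx
    have hc := C.mem_coinvariantForms.1 hc
    rw [rightCoaction, LinearMap.comp_apply, ← ht, map_projZero_map_incl] at hc
    rw [mem_baseForms, ← ht, hc]
    simp

/-- In Δ(dx), computed from x ⊗ 1, the second term of the tensor differential contains d1 = 0. -/
theorem d_mem_baseForms (C : CompleteCalculus P F Ω) {x : Ω} (hx : x ∈ C.baseForms) :
    C.d x ∈ C.baseForms := by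
  have h1 : F.prolongation.d 1 = 0 := by
    have h : F.dP (F.inclP 1) = 0 := by rw [F.dP_inclP, F.d_one, map_zero]
    rwa [map_one] at h
  rw [mem_baseForms, coactLin_d, C.mem_baseForms.1 hx]
  simp [h1]

/-- If `x` and `dx` are horizontal, then the coaction of `x` has closed coefficients in `H`. -/
theorem lTensor_d_eq_zero (C : CompleteCalculus P F Ω) {x : Ω} {t : Ω ⊗[k] H}
    (ht : TensorProduct.map LinearMap.id F.prolongation.incl.toLinearMap t = C.coactLin x)
    (hd : C.d x ∈ C.horizontal) :
    (F.prolongation.d ∘ₗ F.prolongation.incl.toLinearMap).lTensor Ω t = 0 := by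
  obtain ⟨s, hs⟩ := C.mem_horizontal.1 hd
  -- the projection onto the forms of positive degree in the second factor
  let q : F.Prolongation →ₗ[k] F.Prolongation :=
    LinearMap.id - F.prolongation.incl.toLinearMap ∘ₗ F.prolongation.projZero
  have hq : ∀ h, q (F.prolongation.incl h) = 0 := fun h => by
    simp [q, DifferentialCalculus.projZero_incl]
  have hqd : ∀ h, q (F.prolongation.d (F.prolongation.incl h)) =
      F.prolongation.d (F.prolongation.incl h) := fun h => by
    have := F.prolongation.projZero_of_mem_succ
      (F.prolongation.d_mem 0 _ (F.prolongation.incl_mem h))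
    simp [q, this]
  -- The involution tensored with `q` is applied to both expressions for Δ(dx). As `q` kills H, it
  -- annihilates the horizontal expression (`h1`) and the terms dxᵢ ⊗ hᵢ (`h2`).
  have h1 : ∀ u : Ω ⊗[k] H, TensorProduct.map C.degreeInvolution q
      (TensorProduct.map LinearMap.id F.prolongation.incl.toLinearMap u) = 0 := fun u => by
    induction u using TensorProduct.induction_on with
    | zero => simp
    | tmul x h => simp [hq]
    | add x y hx hy => simp only [map_add, hx, hy, add_zero]
  have h2 : ∀ u : Ω ⊗[k] H, TensorProduct.map C.degreeInvolution q
      (TensorProduct.map C.d LinearMap.id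
        (TensorProduct.map LinearMap.id F.prolongation.incl.toLinearMap u)) = 0 := fun u => by
    induction u using TensorProduct.induction_on with
    | zero => simp
    | tmul x h => simp [hq]
    | add x y hx hy => simp only [map_add, hx, hy, add_zero]
  -- On the remaining terms ±xᵢ ⊗ dhᵢ, `q` is the identity because dhᵢ has degree 1, and the second
  -- involution cancels the sign.
  have h3 : ∀ u : Ω ⊗[k] H, TensorProduct.map C.degreeInvolution q
      (TensorProduct.map C.degreeInvolution F.prolongation.d
        (TensorProduct.map LinearMap.id F.prolongation.incl.toLinearMap u)) =
      (F.prolongation.d ∘ₗ F.prolongation.incl.toLinearMap).lTensor Ω u := fun u => by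
    induction u using TensorProduct.induction_on with
    | zero => simp
    | tmul x h => simp [hqd, DGAlgebra.degreeInvolution_degreeInvolution]
    | add x y hx hy => simp only [map_add, hx, hy]
  have h := congrArg (TensorProduct.map C.degreeInvolution q) hs
  rw [h1, coactLin_d, ← ht, map_add, h2, h3, zero_add] at h
  exact h.symm

/-- Closed coefficients in H are scalars when the calculus is connected, so Δx has the form y ⊗ 1,
and the counit identifies y with x. -/
theorem baseForms_eq_horizontal_inf_comap (C : CompleteCalculus P F Ω) (hF : F.IsConnected) :
    C.baseForms = C.horizontal ⊓ C.horizontal.comap C.d := by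
  apply le_antisymm
  · exact fun x hx => ⟨C.baseForms_le_horizontal hx,
      C.baseForms_le_horizontal (C.d_mem_baseForms hx)⟩
  · rintro x ⟨hx, hd⟩
    obtain ⟨t, ht⟩ := C.mem_horizontal.1 hx
    -- Connectedness as exactness of k → H → Γ^∧; injectivity of Γ → Γ^∧ ensures that no further
    -- elements of H become closed in the prolongation.
    have hex : Function.Exact (Algebra.linearMap k H)
        (F.prolongation.d ∘ₗ F.prolongation.incl.toLinearMap) := fun h => by
      have : (F.prolongation.d ∘ₗ F.prolongation.incl.toLinearMap) h = F.formP (F.d h) :=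
        F.dP_inclP h
      rw [this, map_eq_zero_iff _ F.formP_injective, hF h]
      exact ⟨fun ⟨c, hc⟩ => ⟨c, hc.symm⟩, fun ⟨c, hc⟩ => ⟨c, hc.symm⟩⟩
    -- Ω is flat over the field k, so the kernel of id ⊗ d is the image of Ω ⊗ k.
    obtain ⟨s, hs⟩ := (Module.Flat.lTensor_exact Ω hex t).1 (C.lTensor_d_eq_zero ht hd)
    obtain ⟨y, rfl⟩ := (TensorProduct.rid k Ω).symm.surjective s
    have hy : C.coactLin x = y ⊗ₜ 1 := by
      rw [← ht, ← hs]
      simp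
    -- Applying id ⊗ ε to Δx = y ⊗ 1 gives x on one side and y on the other.
    have hxy := C.rid_counitP_coactLin x
    rw [hy] at hxy
    have : y = x := by simpa using hxy
    rw [mem_baseForms, hy, this]

end CompleteCalculus

end QuantumBundle

theorem mainTheorem5 {k H Γ A Ω : Type*} [Field k] [Ring H] [HopfAlgebra k H]
    [AddCommGroup Γ] [Module k Γ] [Module H Γ] [Module Hᵐᵒᵖ Γ] [SMulCommClass H Hᵐᵒᵖ Γ]
    [IsScalarTower k H Γ] [IsScalarTower k Hᵐᵒᵖ Γ] [Ring A] [Algebra k A] [Ring Ω] [Algebra k Ω]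
    (F : QuantumBundle.FirstOrderCalculus k H Γ) (hF : F.IsBicovariant)
    (P : QuantumBundle.ComoduleAlgebra k H A) (hP : P.IsQuantumPrincipalBundle)
    (C : QuantumBundle.CompleteCalculus P F Ω) :
    C.baseForms = C.horizontal ⊓ C.coinvariantForms ∧
      (F.IsConnected → C.baseForms = C.horizontal ⊓ C.horizontal.comap C.d) := by
  exact ⟨C.baseForms_eq_horizontal_inf_coinvariantForms,
    C.baseForms_eq_horizontal_inf_comap⟩
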